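/- Let $A$ be a finite set, and write $A^*$ for the free monoid of words over $A$. For a monoid $M$ and a surjective homomorphism $\pi\colon A^*\to M$, a regular language $R\subseteq A^*$ with $\pi(R)=M$ is called a regular combing of $M$. The monoid $M$ is word-hyperbolic with respect to the regular combing $R$ if the multiplication table $$\mathcal{T}_M(R)=\{\,u\,\#_1\,v\,\#_2\,w^{\mathrm{rev}} \mid u,v,w\in R,\ \pi(u)\pi(v)=\pi(w)\,\}$$ is a context-free language, where $\#_1,\#_2$ are two distinct symbols not in $A$ and $w^{\mathrm{rev}}$ is the word $w$ read backwards. The monoid $M$ is called $\star$-word-hyperbolic if, for some finite set $A$ and some surjective homomorphism $\pi\colon A^*\to M$, it is word-hyperbolic with respect to a regular combing $R\subseteq A^*$ satisfying $R^*=R$, where $R^*$ is the Kleene star of $R$. Theorem. Let $M_1$ and $M_2$ be $\star$-word-hyperbolic monoids. Then the monoid free product $M_1\ast M_2$ is $\star$-word-hyperbolic. -/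

import Mathlib

open scoped Computability

/-- For a monoid `M` with a homomorphism `π : A* → M`, a regular language `R ⊆ A*` is a
*regular combing* of `M` when every element of `M` is represented by some word of `R`
(in particular `π` is then surjective, that is, `A` generates `M`). -/
def IsRegularCombing {A M : Type*} [Monoid M] (π : FreeMonoid A →* M) (R : Language A) : Prop :=
  R.IsRegular ∧ ∀ m : M, ∃ u ∈ R, π (FreeMonoid.ofList u) = m

/-- The multiplication table `{u #₁ v #₂ wʳᵉᵛ | u, v, w ∈ R, u · v = w in M}`, a language over
the alphabet `A` with two new symbols `#₁ = Sum.inr 0` and `#₂ = Sum.inr 1`. -/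
def multiplicationTable {A M : Type*} [Monoid M] (π : FreeMonoid A →* M) (R : Language A) :
    Language (A ⊕ Fin 2) :=
  {x | ∃ u ∈ R, ∃ v ∈ R, ∃ w ∈ R,
    π (FreeMonoid.ofList u) * π (FreeMonoid.ofList v) = π (FreeMonoid.ofList w) ∧
    x = u.map Sum.inl ++ [Sum.inr 0] ++ v.map Sum.inl ++ [Sum.inr 1] ++ w.reverse.map Sum.inl}

/-- `M` is word-hyperbolic with respect to `R`: the language `R` is a regular combing of `M` whose
multiplication table is context-free. -/
def IsWordHyperbolicWith {A M : Type*} [Monoid M] (π : FreeMonoid A →* M) (R : Language A) :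
    Prop :=
  IsRegularCombing π R ∧ (multiplicationTable π R).IsContextFree

/-- `M` is *⋆-word-hyperbolic*: it is word-hyperbolic with respect to some regular combing `R`
(over some finite generating set) with `R* = R`. Finite alphabets may be taken in `Type`. -/
def IsStarWordHyperbolic (M : Type*) [Monoid M] : Prop :=
  ∃ (A : Type) (_ : Finite A) (π : FreeMonoid A →* M) (R : Language A),
    IsWordHyperbolicWith π R ∧ R∗ = R

/-! The combings `R i` of the factors are combined into `(∑ R i)∗`. Since this language is closed
under concatenation, a table entry `u #₁ v #₂ wʳᵉᵛ` is a word `uv # wʳᵉᵛ` with a cut in its left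
part. Hence a transducer that also tests membership in the combing recovers the table from any
context-free `W` of words `x # zʳᵉᵛ` with `x`, `z` equal in the product, provided `W` has all such
words with `x`, `z` in the combing (`isContextFree_multiplicationTable`).

For `W` take everything reachable from `#` by replacing `#` with `p # qʳᵉᵛ`, where `p`, `q` lie in
one `R i` and agree in `M i`, and by inserting words of value `1` next to letters. These rule
languages are transductions of the given tables (`isContextFree_insertionLanguage`), iterated
context-free substitution stays context-free (`Language.IsContextFree.substReaches`), and insertions
preserve equality of the two sides (`exists_of_insertion_reaches`).

Conversely, cut `x` and `z` into blocks from the `R i`. A block of value `1` can be removed, and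
adjacent blocks over the same alphabet can be merged. If neither is possible, both sides are
reduced, so uniqueness of normal forms in the free product matches the block values one by one, and
the two last blocks can be peeled off together (`insertion_reaches_of_blocks`). -/

/-! ### Context-free grammars: bounding the generated language -/

namespace ContextFreeGrammar

/-- The language assigned to a symbol by an interpretation of the nonterminals. -/
def symbolLanguage {T N : Type*} (S : N → Language T) : Symbol T N → Language T
  | .terminal t => {[t]}
  | .nonterminal n => S n

/-- A derivation step replaces one factor of the product by a smaller one, and multiplication of
languages is monotone. -/
theorem prod_symbolLanguage_le_of_derives {T : Type*} {g : ContextFreeGrammar T}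
    {S : g.NT → Language T}
    (hS : ∀ r ∈ g.rules, (r.output.map (symbolLanguage S)).prod ≤ S r.input)
    {u v : List (Symbol T g.NT)} (h : g.Derives u v) :
    (v.map (symbolLanguage S)).prod ≤ (u.map (symbolLanguage S)).prod := by
  induction h with
  | refl => exact le_rfl
  | tail _ hp ih =>
    obtain ⟨r, hr, hrw⟩ := hp
    obtain ⟨p, q, rfl, rfl⟩ := hrw.exists_parts
    refine le_trans ?_ ih
    simp only [List.map_append, List.prod_append, List.map_cons, List.map_nil, List.prod_cons,
      List.prod_nil, mul_one]
    exact mul_le_mul_left (mul_le_mul_right (hS r hr) _) _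

theorem mem_prod_symbolLanguage_terminal_iff {T N : Type*} (S : N → Language T) {v w : List T} :
    v ∈ ((w.map Symbol.terminal).map (symbolLanguage S)).prod ↔ v = w := by
  induction w generalizing v with
  | nil => exact Iff.rfl
  | cons a w ih =>
    constructor
    · intro h
      obtain ⟨_, rfl, b, hb, rfl⟩ := Language.mem_mul.1 h
      rw [ih.1 hb]; rfl
    · rintro rfl
      exact Language.append_mem_mul (a := [a]) (Set.mem_singleton _) (ih.2 rfl)

/-- The generated language lies in every interpretation closed under the rules. This replaces
induction over derivation trees whenever a grammar must be shown to generate nothing extra. -/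
theorem mem_of_generates {T : Type*} {g : ContextFreeGrammar T} {S : g.NT → Language T}
    (hS : ∀ r ∈ g.rules, (r.output.map (symbolLanguage S)).prod ≤ S r.input)
    {w : List T} (h : w ∈ g.language) : w ∈ S g.initial := by
  have h1 := prod_symbolLanguage_le_of_derives hS h ((mem_prod_symbolLanguage_terminal_iff S).2 rfl)
  rwa [List.map_singleton, List.prod_singleton] at h1

theorem derives_of_mem_rules {T : Type*} {g : ContextFreeGrammar T}
    {r : ContextFreeRule T g.NT} (hr : r ∈ g.rules) :
    g.Derives [.nonterminal r.input] r.output :=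
  Produces.single ⟨r, hr, ContextFreeRule.Rewrites.input_output⟩

theorem Derives.append {T : Type*} {g : ContextFreeGrammar T} {u v u' v' : List (Symbol T g.NT)}
    (h : g.Derives u v) (h' : g.Derives u' v') : g.Derives (u ++ u') (v ++ v') :=
  (h.append_right u').trans (h'.append_left v)

end ContextFreeGrammar

/-! ### Finite-state transductions of context-free languages -/

section Transduction

variable {σ B C N : Type*}

/-- The runs of a finite-state transducer: `E s b t` is the set of words that may be emitted
when passing from `s` to `t` while reading `b`. -/
inductive Transduces (E : σ → B → σ → Set (List C)) : σ → List B → σ → List C → Prop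
  | nil (s : σ) : Transduces E s [] s []
  | cons {s t e : σ} {b : B} {o : List C} {w : List B} {y : List C} :
      o ∈ E s b t → Transduces E t w e y → Transduces E s (b :: w) e (o ++ y)

/-- The runs of a transducer on sentential forms, where a nonterminal is annotated with the states
before and after it. -/
inductive Annotates (E : σ → B → σ → Set (List C)) :
    σ → List (Symbol B N) → σ → List (Symbol C (σ × N × σ)) → Prop
  | nil (s : σ) : Annotates E s [] s []
  | terminal {s t e : σ} {b : B} {o : List C} {w : List (Symbol B N)}
      {y : List (Symbol C (σ × N × σ))} :
      o ∈ E s b t → Annotates E t w e y →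
        Annotates E s (.terminal b :: w) e (o.map .terminal ++ y)
  | nonterminal {s t e : σ} {n : N} {w : List (Symbol B N)}
      {y : List (Symbol C (σ × N × σ))} :
      Annotates E t w e y → Annotates E s (.nonterminal n :: w) e (.nonterminal (s, n, t) :: y)

variable {E : σ → B → σ → Set (List C)}

theorem transduces_nil_iff {s e : σ} {y : List C} :
    Transduces E s [] e y ↔ s = e ∧ y = [] := by
  constructor
  · rintro ⟨⟩; exact ⟨rfl, rfl⟩
  · rintro ⟨rfl, rfl⟩; exact .nil _

theorem transduces_cons_iff {s e : σ} {b : B} {w : List B} {y : List C} :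
    Transduces E s (b :: w) e y ↔
      ∃ t, ∃ o ∈ E s b t, ∃ y', Transduces E t w e y' ∧ y = o ++ y' := by
  constructor
  · rintro (_ | ⟨ho, hy⟩); exact ⟨_, _, ho, _, hy, rfl⟩
  · rintro ⟨t, o, ho, y', hy, rfl⟩; exact .cons ho hy

theorem Transduces.append {s t e : σ} {v w : List B} {y z : List C}
    (h : Transduces E s v t y) (h' : Transduces E t w e z) :
    Transduces E s (v ++ w) e (y ++ z) := by
  induction h with
  | nil => exact h'
  | cons ho _ ih => rw [List.append_assoc]; exact .cons ho (ih h')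

theorem Annotates.append {s t e : σ} {v w : List (Symbol B N)} {y z : List (Symbol C (σ × N × σ))}
    (h : Annotates E s v t y) (h' : Annotates E t w e z) :
    Annotates E s (v ++ w) e (y ++ z) := by
  induction h with
  | nil => exact h'
  | terminal ho _ ih => rw [List.append_assoc]; exact .terminal ho (ih h')
  | nonterminal _ ih => exact .nonterminal (ih h')

theorem Annotates.exists_of_append {s e : σ} {v w : List (Symbol B N)}
    {y : List (Symbol C (σ × N × σ))} (h : Annotates E s (v ++ w) e y) :
    ∃ t y₁ y₂, y = y₁ ++ y₂ ∧ Annotates E s v t y₁ ∧ Annotates E t w e y₂ := by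
  induction v generalizing s y with
  | nil => exact ⟨s, [], y, rfl, .nil _, h⟩
  | cons x v ih =>
    rcases h with _ | ⟨ho, h⟩ | h
    · obtain ⟨t, y₁, y₂, rfl, h₁, h₂⟩ := ih h
      exact ⟨t, _, y₂, (List.append_assoc ..).symm, .terminal ho h₁, h₂⟩
    · obtain ⟨t, y₁, y₂, rfl, h₁, h₂⟩ := ih h
      exact ⟨t, _ :: y₁, y₂, rfl, .nonterminal h₁, h₂⟩

theorem finite_setOf_annotates [Finite σ] (hE : ∀ s b t, (E s b t).Finite)
    (s : σ) (w : List (Symbol B N)) (e : σ) : {y | Annotates E s w e y}.Finite := by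
  induction w generalizing s with
  | nil => exact (Set.finite_singleton []).subset fun y hy => by cases hy; rfl
  | cons x w ih =>
    rcases x with b | n
    · refine (Set.finite_iUnion fun t => ((hE s b t).image2
        (fun o y => o.map Symbol.terminal ++ y) (ih t))).subset ?_
      rintro y (_ | ⟨ho, h⟩ | h)
      exact Set.mem_iUnion.2 ⟨_, _, ho, _, h, rfl⟩
    · refine (Set.finite_iUnion fun t => ((ih t).image
        (fun y => Symbol.nonterminal (s, n, t) :: y))).subset ?_
      rintro y (_ | ⟨ho, h⟩ | h)
      exact Set.mem_iUnion.2 ⟨_, _, h, rfl⟩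

theorem Transduces.annotates {s e : σ} {w : List B} {y : List C} (h : Transduces E s w e y) :
    Annotates (N := N) E s (w.map .terminal) e (y.map .terminal) := by
  induction h with
  | nil => exact .nil _
  | cons ho _ ih => rw [List.map_append]; exact .terminal ho ih

/-- The image of a context-free language under a finite-state transducer is context-free. -/
theorem Language.IsContextFree.transduction {B C : Type*} {σ : Type} [Finite σ]
    {E : σ → B → σ → Set (List C)} (hE : ∀ s b t, (E s b t).Finite) (s₀ e₀ : σ)
    {L : Language B} (hL : L.IsContextFree) :
    Language.IsContextFree ({y | ∃ w ∈ L, Transduces E s₀ w e₀ y} : Language C) := by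
  obtain ⟨g, rfl⟩ := hL
  -- Triple construction: `(s, n, e)` generates the outputs of runs from `s` to `e` on terminal
  -- words derived from `n`. Only finitely many annotations of each rule exist.
  let P : Set (ContextFreeRule C (σ × g.NT × σ)) :=
    {r' | ∃ r ∈ g.rules, ∃ s e, ∃ y, Annotates E s r.output e y ∧ r' = ⟨(s, r.input, e), y⟩}
  have hP : P.Finite := by
    refine (g.rules.finite_toSet.biUnion fun r _ => Set.finite_iUnion fun s =>
      Set.finite_iUnion fun e => (finite_setOf_annotates hE s r.output e).image
        fun y => (⟨(s, r.input, e), y⟩ : ContextFreeRule C (σ × g.NT × σ))).subset ?_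
    rintro _ ⟨r, hr, s, e, y, hy, rfl⟩
    exact Set.mem_biUnion hr (Set.mem_iUnion.2 ⟨s, Set.mem_iUnion.2 ⟨e, y, hy, rfl⟩⟩)
  let g' : ContextFreeGrammar C := ⟨σ × g.NT × σ, (s₀, g.initial, e₀), hP.toFinset⟩
  have hrules : ∀ r', r' ∈ g'.rules ↔ r' ∈ P := fun r' => hP.mem_toFinset
  refine ⟨g', Set.Subset.antisymm ?_ ?_⟩
  · let S : g'.NT → Language C := fun x => {y | ∃ w : List B,
      g.Derives [.nonterminal x.2.1] (w.map .terminal) ∧ Transduces E x.1 w x.2.2 y}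
    have key : ∀ (s e : σ) (o : List (Symbol B g.NT)) (y : List (Symbol C g'.NT)),
        Annotates E s o e y → ∀ z ∈ (y.map (ContextFreeGrammar.symbolLanguage S)).prod,
        ∃ w : List B, g.Derives o (w.map .terminal) ∧ Transduces E s w e z := by
      intro s e o y h
      induction h with
      | nil s => rintro z rfl; exact ⟨[], .refl _, .nil _⟩
      | @terminal s t e b o u y ho h ih =>
        intro z hz
        rw [List.map_append, List.prod_append] at hz
        obtain ⟨z₁, hz₁, z₂, hz₂, rfl⟩ := Language.mem_mul.1 hz
        obtain ⟨w, hw, ht⟩ := ih z₂ hz₂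
        have : z₁ = o := (ContextFreeGrammar.mem_prod_symbolLanguage_terminal_iff S).1 hz₁
        subst this
        exact ⟨b :: w, hw.append_left [.terminal b], .cons ho ht⟩
      | @nonterminal s t e n u y h ih =>
        intro z hz
        obtain ⟨z₁, ⟨w₁, hw₁, ht⟩, z₂, hz₂, rfl⟩ := Language.mem_mul.1 hz
        obtain ⟨w, hw, hz⟩ := ih z₂ hz₂
        refine ⟨w₁ ++ w, ?_, ht.append hz⟩
        rw [List.map_append]
        exact ContextFreeGrammar.Derives.append (u := [_]) hw₁ hw
    intro y hy
    refine ContextFreeGrammar.mem_of_generates (S := S) ?_ hy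
    intro r' hr'
    obtain ⟨r, hr, s, e, y, ha, rfl⟩ := (hrules r').1 hr'
    intro z hz
    obtain ⟨w, hw, ht⟩ := key s e _ y ha z hz
    exact ⟨w, (ContextFreeGrammar.derives_of_mem_rules hr).trans hw, ht⟩
  -- Annotations are pulled back along a derivation: the states on either side of a rule's output
  -- become the annotation of its input.
  · have key : ∀ (u v : List (Symbol B g.NT)), g.Derives u v → ∀ s e y, Annotates E s v e y →
        ∃ y₀, Annotates E s u e y₀ ∧ g'.Derives y₀ y := by
      intro u v h
      induction h with
      | refl => exact fun s e y h => ⟨y, h, .refl _⟩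
      | tail _ hp ih =>
        obtain ⟨r, hr, hrw⟩ := hp
        obtain ⟨p, q, rfl, rfl⟩ := hrw.exists_parts
        intro s e y h
        obtain ⟨t', _, y₃, rfl, h, h₃⟩ := h.exists_of_append
        obtain ⟨t, y₁, y₂, rfl, h₁, h₂⟩ := h.exists_of_append
        obtain ⟨y₀, h₀, hd⟩ := ih s e (y₁ ++ [.nonterminal (t, r.input, t')] ++ y₃)
          ((h₁.append (.nonterminal (.nil _))).append h₃)
        refine ⟨y₀, h₀, hd.trans ?_⟩
        have : (⟨(t, r.input, t'), y₂⟩ : ContextFreeRule C g'.NT) ∈ g'.rules :=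
          (hrules _).2 ⟨r, hr, t, t', y₂, h₂, rfl⟩
        exact ((ContextFreeGrammar.derives_of_mem_rules this).append_left y₁).append_right y₃
    rintro y ⟨w, hw, ht⟩
    obtain ⟨y₀, h₀, hd⟩ := key _ _ hw _ _ _ ht.annotates
    rcases h₀ with _ | _ | h₀
    cases h₀
    exact hd

end Transduction

/-! ### Iterated substitution -/

section IteratedSubstitution

/-- One step of rewriting, where the letter `lhs i` may be replaced by any word of `rhs i`. -/
inductive SubstStep {ι X : Type*} (lhs : ι → X) (rhs : ι → Language X) :
    List X → List X → Prop
  | mk (i : ι) {c : List X} (p q : List X) :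
      c ∈ rhs i → SubstStep lhs rhs (p ++ lhs i :: q) (p ++ c ++ q)

/-- The reflexive transitive closure of `SubstStep`. -/
abbrev SubstReaches {ι X : Type*} (lhs : ι → X) (rhs : ι → Language X) :
    List X → List X → Prop :=
  Relation.ReflTransGen (SubstStep lhs rhs)

variable {ι X : Type*} {lhs : ι → X} {rhs : ι → Language X}

theorem SubstStep.append_left {u v : List X} (h : SubstStep lhs rhs u v) (p : List X) :
    SubstStep lhs rhs (p ++ u) (p ++ v) := by
  obtain ⟨i, p', q, hc⟩ := h
  simpa only [List.append_assoc, List.cons_append] using SubstStep.mk (lhs := lhs) i (p ++ p') q hc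

theorem SubstStep.append_right {u v : List X} (h : SubstStep lhs rhs u v) (q : List X) :
    SubstStep lhs rhs (u ++ q) (v ++ q) := by
  obtain ⟨i, p, q', hc⟩ := h
  simpa only [List.append_assoc, List.cons_append] using SubstStep.mk (lhs := lhs) i p (q' ++ q) hc

theorem SubstReaches.append {u v u' v' : List X} (h : SubstReaches lhs rhs u v)
    (h' : SubstReaches lhs rhs u' v') : SubstReaches lhs rhs (u ++ u') (v ++ v') :=
  (h.lift (· ++ u') fun _ _ h => h.append_right u').trans
    (h'.lift (v ++ ·) fun _ _ h => h.append_left v)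

/-- An interpretation of the letters that is compatible with the rules bounds the words that can
be reached. -/
theorem SubstReaches.mem_prod {S : X → Language X} (hS : ∀ x, [x] ∈ S x)
    (hrule : ∀ i, ∀ c ∈ rhs i, (c.map S).prod ≤ S (lhs i)) {u v : List X}
    (h : SubstReaches lhs rhs u v) : v ∈ (u.map S).prod := by
  -- As each letter belongs to its own interpretation, `v` lies in the product taken over `v`; it
  -- remains to see that products shrink along rewriting.
  suffices (v.map S).prod ≤ (u.map S).prod by
    apply this
    clear h this
    induction v with
    | nil => exact Language.nil_mem_one
    | cons a w ih =>
      simp only [List.map_cons, List.prod_cons]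
      exact Language.append_mem_mul (a := [a]) (hS a) ih
  induction h with
  | refl => exact le_rfl
  | tail _ hp ih =>
    obtain ⟨i, p, q, hc⟩ := hp
    refine le_trans ?_ ih
    simp only [List.map_append, List.prod_append, List.map_cons, List.prod_cons, ← mul_assoc]
    exact mul_le_mul_left (mul_le_mul_right (hrule i _ hc) _) _

/-- Closure of context-free languages under iterated substitution. -/
theorem Language.IsContextFree.substReaches {ι X : Type} [Finite ι] [Finite X] (lhs : ι → X)
    {rhs : ι → Language X} (h : ∀ i, (rhs i).IsContextFree) (x₀ : X) :
    Language.IsContextFree ({w | SubstReaches lhs rhs [x₀] w} : Language X) := by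
  choose g hg using h
  -- Each letter `x` doubles as a nonterminal `inl x`, which either becomes the terminal `x` or
  -- starts the grammar of a rule with left side `x`. The map `φ` turns terminals of `g i` into such
  -- nonterminals, so that rewriting can continue.
  let NT := X ⊕ Σ i, (g i).NT
  let φ (i : ι) : Symbol X (g i).NT → Symbol X NT
    | .terminal x => .nonterminal (.inl x)
    | .nonterminal n => .nonterminal (.inr ⟨i, n⟩)
  let P : Set (ContextFreeRule X NT) :=
    Set.range (fun x : X => ⟨.inl x, [.terminal x]⟩) ∪
    Set.range (fun i => ⟨.inl (lhs i), [.nonterminal (.inr ⟨i, (g i).initial⟩)]⟩) ∪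
    ⋃ i, (fun r : ContextFreeRule X (g i).NT => ⟨.inr ⟨i, r.input⟩, r.output.map (φ i)⟩) ''
      {r | r ∈ (g i).rules}
  have hP : P.Finite := ((Set.finite_range _).union (Set.finite_range _)).union
    (Set.finite_iUnion fun i => ((g i).rules.finite_toSet.image _))
  let g' : ContextFreeGrammar X := ⟨NT, .inl x₀, hP.toFinset⟩
  have hrules : ∀ r', r' ∈ g'.rules ↔ r' ∈ P := fun r' => hP.mem_toFinset
  have h₁ (x : X) : g'.Derives [.nonterminal (.inl x)] [.terminal x] :=
    ContextFreeGrammar.derives_of_mem_rules ((hrules _).2 (.inl (.inl ⟨x, rfl⟩)))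
  have h₂ (i : ι) : g'.Derives [.nonterminal (.inl (lhs i))]
      [.nonterminal (.inr ⟨i, (g i).initial⟩)] :=
    ContextFreeGrammar.derives_of_mem_rules ((hrules _).2 (.inl (.inr ⟨i, rfl⟩)))
  have h₃ (i : ι) (r) (hr : r ∈ (g i).rules) :
      g'.Derives [.nonterminal (.inr ⟨i, r.input⟩)] (r.output.map (φ i)) :=
    ContextFreeGrammar.derives_of_mem_rules
      ((hrules _).2 (.inr (Set.mem_iUnion.2 ⟨i, r, hr, rfl⟩)))
  refine ⟨g', Set.Subset.antisymm ?_ ?_⟩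
  · let S : NT → Language X
      | .inl x => {w | SubstReaches lhs rhs [x] w}
      | .inr ⟨i, n⟩ => {w | ∃ c : List X, (g i).Derives [.nonterminal n] (c.map .terminal) ∧
          SubstReaches lhs rhs c w}
    have key (i : ι) (o : List (Symbol X (g i).NT)) : ∀ w,
        w ∈ ((o.map (φ i)).map (ContextFreeGrammar.symbolLanguage S)).prod →
        ∃ c : List X, (g i).Derives o (c.map .terminal) ∧ SubstReaches lhs rhs c w := by
      induction o with
      | nil => rintro w rfl; exact ⟨[], .refl _, .refl⟩
      | cons s o ih =>
        intro w hw
        obtain ⟨w₁, hw₁, w₂, hw₂, rfl⟩ := Language.mem_mul.1 hw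
        obtain ⟨c, hc, hr⟩ := ih w₂ hw₂
        rcases s with x | n
        · exact ⟨x :: c, hc.append_left [.terminal x], SubstReaches.append (u := [x]) hw₁ hr⟩
        · obtain ⟨c₁, hc₁, hr₁⟩ := hw₁
          refine ⟨c₁ ++ c, ?_, hr₁.append hr⟩
          rw [List.map_append]
          exact ContextFreeGrammar.Derives.append (u := [_]) hc₁ hc
    intro w hw
    refine ContextFreeGrammar.mem_of_generates (S := S) ?_ hw
    intro r' hr'
    rcases (hrules r').1 hr' with (⟨x, rfl⟩ | ⟨i, rfl⟩) | hr'
    · intro w hw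
      rw [List.map_singleton, List.prod_singleton] at hw
      obtain rfl : w = [x] := hw
      exact Relation.ReflTransGen.refl
    · intro w hw
      obtain ⟨c, hc, hr⟩ : w ∈ S (.inr ⟨i, (g i).initial⟩) := by
        rwa [List.map_singleton, List.prod_singleton] at hw
      have hc : c ∈ rhs i := hg i ▸ hc
      have := SubstStep.mk (lhs := lhs) i [] [] hc
      rw [List.append_nil] at this
      exact (Relation.ReflTransGen.single this).trans hr
    · obtain ⟨i, r, hr, rfl⟩ := Set.mem_iUnion.1 hr'
      intro w hw
      obtain ⟨c, hc, hr'⟩ := key i _ w hw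
      exact ⟨c, (ContextFreeGrammar.derives_of_mem_rules hr).trans hc, hr'⟩
  -- All substitutions are carried out on nonterminals `inl x`; these become terminals only at the
  -- end.
  · have hφ (i : ι) (u v) (h : (g i).Derives u v) : g'.Derives (u.map (φ i)) (v.map (φ i)) := by
      induction h with
      | refl => exact .refl _
      | tail _ hp ih =>
        obtain ⟨r, hr, hrw⟩ := hp
        obtain ⟨p, q, rfl, rfl⟩ := hrw.exists_parts
        refine ih.trans ?_
        simp only [List.map_append]
        exact ((h₃ i r hr).append_left _).append_right _
    have hreach (u v : List X) (h : SubstReaches lhs rhs u v) :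
        g'.Derives (u.map (.nonterminal ∘ .inl)) (v.map (.nonterminal ∘ .inl)) := by
      induction h with
      | refl => exact .refl _
      | tail _ hp ih =>
        obtain @⟨i, c, p, q, hc⟩ := hp
        refine ih.trans ?_
        have hc' : (g i).Derives [.nonterminal (g i).initial] (c.map .terminal) := by
          rw [← hg i] at hc; exact hc
        have := (h₂ i).trans (hφ i _ _ hc')
        rw [List.map_map] at this
        rw [← List.singleton_append, ← List.append_assoc]
        simp only [List.map_append]
        exact (this.append_left _).append_right _
    have hterm (w : List X) : g'.Derives (w.map (.nonterminal ∘ .inl)) (w.map .terminal) := by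
      induction w with
      | nil => exact .refl _
      | cons x w ih => exact ContextFreeGrammar.Derives.append (u := [_]) (h₁ x) ih
    intro w hw
    exact (hreach _ _ hw).trans (hterm w)

end IteratedSubstitution

/-! ### Closure properties of regular languages -/

namespace Language

theorem IsRegular.of_nfa {B σ : Type} [Finite σ] (M : NFA B σ) : M.accepts.IsRegular := by
  have := Fintype.ofFinite (Set σ)
  exact ⟨_, this, M.toDFA, M.toDFA_correct⟩

/-- To show that an automaton accepts a language, it suffices to assign to each state a language
that satisfies the equations of the automaton. -/
theorem mem_acceptsFrom_iff_of_step {B σ : Type*} (M : NFA B σ) (Lan : σ → Language B)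
    (hnil : ∀ s, [] ∈ Lan s ↔ s ∈ M.accept)
    (hcons : ∀ s b w, b :: w ∈ Lan s ↔ ∃ t ∈ M.step s b, w ∈ Lan t) (S : Set σ) (w : List B) :
    w ∈ M.acceptsFrom S ↔ ∃ s ∈ S, w ∈ Lan s := by
  induction w generalizing S with
  | nil => rw [NFA.nil_mem_acceptsFrom]; simp only [hnil]
  | cons b w ih =>
    rw [NFA.cons_mem_acceptsFrom, ih]
    simp only [hcons, NFA.mem_stepSet]
    constructor
    · rintro ⟨t, ⟨s, hs, ht⟩, hw⟩; exact ⟨s, hs, t, ht, hw⟩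
    · rintro ⟨s, hs, t, ht, hw⟩; exact ⟨t, ⟨s, hs, ht⟩, hw⟩

theorem IsRegular.zero {B : Type} : (0 : Language B).IsRegular :=
  ⟨Unit, inferInstance, ⟨fun _ _ => (), (), ∅⟩, rfl⟩

theorem IsRegular.sum {B ι : Type} (s : Finset ι) {L : ι → Language B}
    (h : ∀ i, (L i).IsRegular) : (∑ i ∈ s, L i).IsRegular := by
  classical
  induction s using Finset.induction_on with
  | empty => exact .zero
  | insert i s hi ih => rw [Finset.sum_insert hi]; exact (h i).add ih

theorem mem_sum {B ι : Type*} {s : Finset ι} {L : ι → Language B} {w : List B} :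
    w ∈ ∑ i ∈ s, L i ↔ ∃ i ∈ s, w ∈ L i := by
  classical
  induction s using Finset.induction_on with
  | empty => simp [Language.notMem_zero]
  | insert i s hi ih => rw [Finset.sum_insert hi, Language.mem_add, ih]; simp

/-- The automaton guesses a preimage under `f` of each letter it reads. -/
theorem IsRegular.map {B C : Type} (f : B → C) {L : Language B} (h : L.IsRegular) :
    (Language.map f L).IsRegular := by
  obtain ⟨σ, _, D, rfl⟩ := h
  let M : NFA C σ := ⟨fun s c => {t | ∃ b, f b = c ∧ D.step s b = t}, {D.start}, D.accept⟩
  have key := mem_acceptsFrom_iff_of_step M (fun s => Language.map f (D.acceptsFrom s))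
    (by
      intro s
      constructor
      · rintro ⟨v, hv, h⟩
        obtain rfl : v = [] := by simpa using h
        exact hv
      · exact fun h => ⟨[], h, rfl⟩)
    (by
      intro s c w
      constructor
      · rintro ⟨v, hv, h⟩
        obtain ⟨b, v, rfl, rfl, rfl⟩ := List.map_eq_cons_iff.1 h
        exact ⟨_, ⟨b, rfl, rfl⟩, v, hv, rfl⟩
      · rintro ⟨_, ⟨b, rfl, rfl⟩, v, hv, rfl⟩
        exact ⟨b :: v, hv, rfl⟩)
    {D.start}
  have : M.accepts = Language.map f D.accepts := by
    ext w
    refine (key w).trans ?_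
    simp only [Set.mem_singleton_iff, exists_eq_left]
    rfl
  exact this ▸ .of_nfa M

theorem IsRegular.kstar {B : Type} {L : Language B} (h : L.IsRegular) : (L∗).IsRegular := by
  obtain ⟨σ, _, D, rfl⟩ := h
  -- `none` is a fresh accepting start state; from an accepting `q` the next letter may either
  -- continue the current factor or begin a new one.
  let M : NFA B (Option σ) := ⟨fun s b => s.elim {some (D.step D.start b)}
    (fun q => {t | t = some (D.step q b) ∨ q ∈ D.accept ∧ t = some (D.step D.start b)}),
    {none}, {t | ∀ q, t = some q → q ∈ D.accept}⟩
  have hstar (b : B) (w : List B) : b :: w ∈ D.accepts∗ ↔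
      w ∈ D.acceptsFrom (D.step D.start b) * D.accepts∗ := by
    rw [Language.mem_mul]
    constructor
    · rw [Language.mem_kstar_iff_exists_nonempty]
      rintro ⟨_ | ⟨l, S⟩, h, hS⟩
      · simp at h
      · obtain ⟨hl, hne⟩ := hS l (by simp)
        obtain ⟨c, l, rfl⟩ := List.exists_cons_of_ne_nil hne
        obtain ⟨rfl, rfl⟩ : b = c ∧ w = l ++ S.flatten := by simpa using h
        exact ⟨l, hl, S.flatten, Language.join_mem_kstar fun y hy => (hS y (by simp [hy])).1, rfl⟩
    · rintro ⟨l, hl, v, hv, rfl⟩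
      obtain ⟨S, rfl, hS⟩ := Language.mem_kstar.1 hv
      refine Language.mem_kstar.2 ⟨(b :: l) :: S, by simp, ?_⟩
      intro y hy
      rcases List.mem_cons.1 hy with rfl | hy
      · exact hl
      · exact hS y hy
  have hmul (q : σ) (b : B) (w : List B) : b :: w ∈ D.acceptsFrom q * D.accepts∗ ↔
      w ∈ D.acceptsFrom (D.step q b) * D.accepts∗ ∨ q ∈ D.accept ∧ b :: w ∈ D.accepts∗ := by
    simp only [Language.mem_mul]
    constructor
    · rintro ⟨_ | ⟨c, l⟩, hl, v, hv, h⟩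
      · obtain rfl : v = b :: w := h
        exact .inr ⟨hl, hv⟩
      · obtain ⟨rfl, rfl⟩ : c = b ∧ l ++ v = w := by simpa using h
        exact .inl ⟨l, hl, v, hv, rfl⟩
    · rintro (⟨l, hl, v, hv, rfl⟩ | ⟨hq, hv⟩)
      · exact ⟨b :: l, hl, v, hv, rfl⟩
      · exact ⟨[], hq, _, hv, rfl⟩
  have key := mem_acceptsFrom_iff_of_step M
    (fun s => s.elim (D.accepts∗) fun q => D.acceptsFrom q * D.accepts∗)
    (by
      rintro (_ | q)
      · exact iff_of_true (Language.nil_mem_kstar _) (by simp [M])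
      · change [] ∈ D.acceptsFrom q * _ ↔ _
        rw [Language.mem_mul]
        constructor
        · rintro ⟨a, ha, b, hb, h⟩
          obtain ⟨rfl, rfl⟩ := List.append_eq_nil_iff.1 h
          rintro _ ⟨⟩; exact ha
        · exact fun h => ⟨[], h q rfl, [], Language.nil_mem_kstar _, rfl⟩)
    (by
      rintro (_ | q) b w
      · refine (hstar b w).trans ?_
        simp [M]
      · refine (hmul q b w).trans ?_
        rw [hstar]
        constructor
        · rintro (h | ⟨hq, h⟩)
          · exact ⟨_, .inl rfl, h⟩
          · exact ⟨_, .inr ⟨hq, rfl⟩, h⟩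
        · rintro ⟨_, (rfl | ⟨hq, rfl⟩), h⟩
          · exact .inl h
          · exact .inr ⟨hq, h⟩)
    {none}
  have : M.accepts = D.accepts∗ := by
    ext w
    refine (key w).trans ?_
    simp
  exact this ▸ .of_nfa M

theorem nil_mem_of_kstar_eq {B : Type*} {L : Language B} (h : L∗ = L) : [] ∈ L :=
  h ▸ Language.nil_mem_kstar L

theorem append_mem_of_kstar_eq {B : Type*} {L : Language B} (h : L∗ = L) {u v : List B}
    (hu : u ∈ L) (hv : v ∈ L) : u ++ v ∈ L := by
  rw [← h]
  exact Language.mem_kstar.2 ⟨[u, v], by simp, by simp [hu, hv]⟩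

end Language

/-! ### Two-sided words and the insertion languages -/

/-- Two copies of an alphabet, for the letters to the left and to the right of a central symbol. -/
inductive TwoSided (A : Type*)
  | left (a : A)
  | mid
  | right (a : A)

namespace TwoSided

variable {A B : Type*}

instance [Finite A] : Finite (TwoSided A) :=
  .of_surjective (fun x : Option (A ⊕ A) => x.elim mid (Sum.elim left right)) <| by
    rintro (a | _ | a)
    · exact ⟨some (.inl a), rfl⟩
    · exact ⟨none, rfl⟩
    · exact ⟨some (.inr a), rfl⟩

/-- The symbol is a letter of the left copy. -/
def IsLeft : TwoSided A → Prop
  | left _ => True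
  | _ => False

/-- The symbol is a letter of the right copy. -/
def IsRight : TwoSided A → Prop
  | right _ => True
  | _ => False

end TwoSided

/-- A context-free language is mapped to a context-free language by a transducer which emits words
of bounded length over a finite alphabet. -/
theorem Language.IsContextFree.transduction_of_length_le {B C : Type*} {σ : Type} [Finite σ]
    [Finite C] {E : σ → B → σ → Set (List C)} (n : ℕ) (hE : ∀ s b t, ∀ o ∈ E s b t, o.length ≤ n)
    (s₀ e₀ : σ) {L : Language B} (hL : L.IsContextFree) :
    Language.IsContextFree ({y | ∃ w ∈ L, Transduces E s₀ w e₀ y} : Language C) :=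
  hL.transduction (fun s b t => (List.finite_length_le C n).subset (hE s b t)) s₀ e₀

section Insertion

variable {A B M : Type*} [Monoid M]

/-- The words `p X qʳᵉᵛ` with `p` and `q` in `R` representing the same element, where `p` has to
be empty if `X` is a letter of the right copy and `q` has to be empty if `X` is a letter of the
left copy. -/
def insertionLanguage (π : FreeMonoid A →* M) (R : Language A) (f : A → B) (X : TwoSided B) :
    Language (TwoSided B) :=
  {y | ∃ p ∈ R, ∃ q ∈ R, π (FreeMonoid.ofList p) = π (FreeMonoid.ofList q) ∧
    (X.IsRight → p = []) ∧ (X.IsLeft → q = []) ∧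
    y = p.map (.left ∘ f) ++ X :: q.reverse.map (.right ∘ f)}

/-- The transitions of a transducer which extracts `insertionLanguage` from a multiplication
table. -/
inductive InsertionStep (f : A → B) (X : TwoSided B) :
    Fin 3 → A ⊕ Fin 2 → Fin 3 → List (TwoSided B) → Prop
  | start : InsertionStep f X 0 (.inr 0) 1 []
  | left (a : A) : ¬ X.IsRight → InsertionStep f X 1 (.inl a) 1 [.left (f a)]
  | mid : InsertionStep f X 1 (.inr 1) 2 [X]
  | right (a : A) : ¬ X.IsLeft → InsertionStep f X 2 (.inl a) 2 [.right (f a)]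

variable {f : A → B} {X : TwoSided B}

theorem transduces_insertion_right {w : List A} {y : List (TwoSided B)} :
    Transduces (fun s b t => {o | InsertionStep f X s b t o}) 2 (w.map .inl) 2 y ↔
      (X.IsLeft → w = []) ∧ y = w.map (.right ∘ f) := by
  induction w generalizing y with
  | nil => simp [transduces_nil_iff]
  | cons a w ih =>
    rw [List.map_cons, transduces_cons_iff]
    constructor
    · rintro ⟨t, o, ho, y', hy, rfl⟩
      cases ho with
      | right _ h =>
        rw [(ih.1 hy).2]
        exact ⟨fun h' => absurd h' h, rfl⟩
    · rintro ⟨h, rfl⟩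
      have h : ¬ X.IsLeft := fun h' => by simpa using h h'
      exact ⟨2, _, .right a h, _, ih.2 ⟨fun h' => absurd h' h, rfl⟩, rfl⟩

theorem transduces_insertion_left {v : List A} {r : List (A ⊕ Fin 2)} {e : Fin 3}
    {y : List (TwoSided B)} :
    Transduces (fun s b t => {o | InsertionStep f X s b t o}) 1 (v.map .inl ++ .inr 1 :: r) e y ↔
      (X.IsRight → v = []) ∧ ∃ y', y = v.map (.left ∘ f) ++ X :: y' ∧
        Transduces (fun s b t => {o | InsertionStep f X s b t o}) 2 r e y' := by
  induction v generalizing y with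
  | nil =>
    rw [List.map_nil, List.nil_append, transduces_cons_iff]
    constructor
    · rintro ⟨t, o, ho, y', hy, rfl⟩
      cases ho with
      | mid => exact ⟨fun _ => rfl, y', rfl, hy⟩
    · rintro ⟨-, y', rfl, hy⟩
      exact ⟨2, _, .mid, y', hy, rfl⟩
  | cons a v ih =>
    rw [List.map_cons, List.cons_append, transduces_cons_iff]
    constructor
    · rintro ⟨t, o, ho, y', hy, rfl⟩
      cases ho with
      | left _ h =>
        obtain ⟨-, y', rfl, hy'⟩ := ih.1 hy
        exact ⟨fun h' => absurd h' h, y', rfl, hy'⟩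
    · rintro ⟨h, y', rfl, hy⟩
      have h : ¬ X.IsRight := fun h' => by simpa using h h'
      exact ⟨1, _, .left a h, _, ih.2 ⟨fun h' => absurd h' h, y', rfl, hy⟩, rfl⟩

/-- Table entries with `u = []` are the words `#₁ v #₂ wʳᵉᵛ` with `v` and `w` equal in `M`. The
transducer drops `#₁`, turns `#₂` into `X` and marks each letter with its side; the blocked
transitions enforce the emptiness conditions. -/
theorem IsWordHyperbolicWith.isContextFree_insertionLanguage [Finite B] {π : FreeMonoid A →* M}
    {R : Language A} (h : IsWordHyperbolicWith π R) (hR : [] ∈ R) (f : A → B) (X : TwoSided B) :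
    (insertionLanguage π R f X).IsContextFree := by
  have key := h.2.transduction_of_length_le (E := fun s b t => {o | InsertionStep f X s b t o}) 1
    (by rintro s b t o (_ | _ | _ | _) <;> simp) 0 2
  refine (congrArg _ (Set.Subset.antisymm ?_ ?_)).mp key
  · rintro y ⟨_, ⟨u, hu, v, hv, w, hw, he, rfl⟩, ht⟩
    -- The only move out of state `0` reads `#₁`, which forces `u = []`.
    cases u with
    | cons a u =>
      obtain ⟨t, o, ho, -⟩ := transduces_cons_iff.1 ht
      cases ho
    | nil =>
      obtain ⟨t, o, ho, y', ht₀, rfl⟩ := transduces_cons_iff.1 ht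
      cases ho with
      | start =>
        have ht : Transduces (fun s b t => {o | InsertionStep f X s b t o}) 1
            (v.map .inl ++ [.inr 1] ++ w.reverse.map .inl) 2 y' := ht₀
        rw [List.append_assoc] at ht
        obtain ⟨h₁, y', rfl, ht'⟩ := transduces_insertion_left.1 ht
        obtain ⟨h₂, rfl⟩ := transduces_insertion_right.1 ht'
        refine ⟨v, hv, w, hw, ?_, h₁, fun h => List.reverse_eq_nil_iff.1 (h₂ h), rfl⟩
        simpa using he
  · rintro _ ⟨p, hp, q, hq, he, h₁, h₂, rfl⟩
    refine ⟨_, ⟨[], hR, p, hp, q, hq, by simpa using he, rfl⟩, ?_⟩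
    have ht : Transduces (fun s b t => {o | InsertionStep f X s b t o}) 1
        (p.map .inl ++ .inr 1 :: q.reverse.map .inl) 2 _ :=
      transduces_insertion_left.2 ⟨h₁, _, rfl,
        transduces_insertion_right.2 ⟨fun h => List.reverse_eq_nil_iff.2 (h₂ h), rfl⟩⟩
    have h0 : [] ∈ {o | InsertionStep f X 0 (.inr 0) 1 o} := .start
    simpa using Transduces.cons (E := fun s b t => {o | InsertionStep f X s b t o}) h0 ht

end Insertion

/-! ### From two-sided words to the multiplication table -/

section MultiplicationTable

variable {A σ : Type*}

/-- The transitions of a transducer which inserts `#₁` into the left part of a word over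
`TwoSided A` and checks that the three parts are accepted by `D`, the last one read backwards. -/
inductive TableStep (D : DFA A σ) :
    Fin 3 × σ → TwoSided A → Fin 3 × σ → List (A ⊕ Fin 2) → Prop
  | left (q : σ) (a : A) : TableStep D (0, q) (.left a) (0, D.step q a) [.inl a]
  | cut (q : σ) (a : A) : q ∈ D.accept →
      TableStep D (0, q) (.left a) (1, D.step D.start a) [.inr 0, .inl a]
  | cut_mid (q e : σ) : q ∈ D.accept → e ∈ D.accept →
      TableStep D (0, q) .mid (2, e) [.inr 0, .inr 1]
  | left' (q : σ) (a : A) : TableStep D (1, q) (.left a) (1, D.step q a) [.inl a]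
  | mid (q e : σ) : q ∈ D.accept → e ∈ D.accept → TableStep D (1, q) .mid (2, e) [.inr 1]
  | right (q : σ) (a : A) : TableStep D (2, D.step q a) (.right a) (2, q) [.inl a]

variable {D : DFA A σ}

/-- The right part is a reversed word, so `D` is run backwards, from a guessed state down to its
start. -/
theorem transduces_table_right {w : List A} {q : σ} {y : List (A ⊕ Fin 2)} :
    Transduces (fun s b t => {o | TableStep D s b t o}) (2, q) (w.reverse.map .right) (2, D.start) y
      ↔ D.eval w = q ∧ y = w.reverse.map .inl := by
  induction w using List.reverseRecOn generalizing q y with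
  | nil => simp [transduces_nil_iff, eq_comm]
  | append_singleton w a ih =>
    rw [List.reverse_append, List.reverse_singleton, List.singleton_append, List.map_cons,
      transduces_cons_iff, DFA.eval_append_singleton]
    constructor
    · rintro ⟨t, o, ho, y', hy, rfl⟩
      cases ho with
      | right q _ =>
        obtain ⟨rfl, rfl⟩ := ih.1 hy
        exact ⟨rfl, rfl⟩
    · rintro ⟨rfl, rfl⟩
      exact ⟨_, _, .right _ a, _, ih.2 ⟨rfl, rfl⟩, rfl⟩

theorem transduces_table_snd {v : List A} {r : List (TwoSided A)} {q : σ} {s : Fin 3 × σ}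
    {y : List (A ⊕ Fin 2)} :
    Transduces (fun s b t => {o | TableStep D s b t o}) (1, q) (v.map .left ++ .mid :: r) s y ↔
      D.evalFrom q v ∈ D.accept ∧ ∃ e ∈ D.accept, ∃ y', y = v.map .inl ++ .inr 1 :: y' ∧
        Transduces (fun s b t => {o | TableStep D s b t o}) (2, e) r s y' := by
  induction v generalizing q y with
  | nil =>
    rw [List.map_nil, List.nil_append, transduces_cons_iff]
    constructor
    · rintro ⟨t, o, ho, y', hy, rfl⟩
      cases ho with
      | mid _ e hq he => exact ⟨hq, e, he, y', rfl, hy⟩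
    · rintro ⟨hq, e, he, y', rfl, hy⟩
      exact ⟨_, _, .mid q e hq he, y', hy, rfl⟩
  | cons a v ih =>
    rw [List.map_cons, List.cons_append, transduces_cons_iff, DFA.evalFrom_cons]
    constructor
    · rintro ⟨t, o, ho, y', hy, rfl⟩
      cases ho with
      | left' =>
        obtain ⟨hv, e, he, y', rfl, hy'⟩ := ih.1 hy
        exact ⟨hv, e, he, y', rfl, hy'⟩
    · rintro ⟨hv, e, he, y', rfl, hy⟩
      exact ⟨_, _, .left' q a, _, ih.2 ⟨hv, e, he, y', rfl, hy⟩, rfl⟩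

/-- The cut is made while reading the first letter of `v`. An empty `v` is cut at the central symbol
instead, and `hD` says that this `v` is accepted. -/
theorem transduces_table_fst (hD : D.start ∈ D.accept) {x : List A} {r : List (TwoSided A)}
    {q : σ} {s : Fin 3 × σ} {y : List (A ⊕ Fin 2)} :
    Transduces (fun s b t => {o | TableStep D s b t o}) (0, q) (x.map .left ++ .mid :: r) s y ↔
      ∃ u v, x = u ++ v ∧ D.evalFrom q u ∈ D.accept ∧ D.eval v ∈ D.accept ∧ ∃ e ∈ D.accept, ∃ y',
        y = u.map .inl ++ .inr 0 :: (v.map .inl ++ .inr 1 :: y') ∧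
        Transduces (fun s b t => {o | TableStep D s b t o}) (2, e) r s y' := by
  induction x generalizing q y with
  | nil =>
    rw [List.map_nil, List.nil_append, transduces_cons_iff]
    constructor
    · rintro ⟨t, o, ho, y', hy, rfl⟩
      cases ho with
      | cut_mid _ e hq he => exact ⟨[], [], rfl, hq, hD, e, he, y', rfl, hy⟩
    · rintro ⟨u, v, h, hq, -, e, he, y', rfl, hy⟩
      obtain ⟨rfl, rfl⟩ := List.append_eq_nil_iff.1 h.symm
      exact ⟨_, _, .cut_mid q e hq he, y', hy, rfl⟩
  | cons a x ih =>
    rw [List.map_cons, List.cons_append, transduces_cons_iff]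
    constructor
    · rintro ⟨t, o, ho, y', hy, rfl⟩
      cases ho with
      | left =>
        obtain ⟨u, v, rfl, hu, hv, e, he, y', rfl, hy'⟩ := ih.1 hy
        exact ⟨a :: u, v, rfl, hu, hv, e, he, y', rfl, hy'⟩
      | cut _ _ hq =>
        obtain ⟨hv, e, he, y', rfl, hy'⟩ := transduces_table_snd.1 hy
        exact ⟨[], a :: x, rfl, hq, hv, e, he, y', rfl, hy'⟩
    · rintro ⟨_ | ⟨b, u⟩, v, h, hu, hv, e, he, y', rfl, hy⟩
      · obtain rfl : v = a :: x := h.symm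
        exact ⟨_, _, .cut q a hu, _, transduces_table_snd.2 ⟨hv, e, he, y', rfl, hy⟩, rfl⟩
      · obtain ⟨rfl, rfl⟩ : a = b ∧ x = u ++ v := by simpa using h
        exact ⟨_, _, .left q a, _, ih.2 ⟨u, v, rfl, hu, hv, e, he, y', rfl, hy⟩, rfl⟩

/-- For a language closed under concatenation, the multiplication table is context-free as soon as
some context-free language consists of words `x # zʳᵉᵛ` with `x` and `z` equal in `M`, and contains
all those with `x` and `z` in `R`. -/
theorem isContextFree_multiplicationTable {A : Type} {M : Type*} [Finite A] [Monoid M]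
    {π : FreeMonoid A →* M}
    {R : Language A} (hR : R.IsRegular) (hstar : R∗ = R) {W : Language (TwoSided A)}
    (hW : W.IsContextFree)
    (sound : ∀ w ∈ W, ∃ x z, w = x.map .left ++ .mid :: z.reverse.map .right ∧
      π (FreeMonoid.ofList x) = π (FreeMonoid.ofList z))
    (complete : ∀ x ∈ R, ∀ z ∈ R, π (FreeMonoid.ofList x) = π (FreeMonoid.ofList z) →
      x.map .left ++ .mid :: z.reverse.map .right ∈ W) :
    (multiplicationTable π R).IsContextFree := by
  have hnil := Language.nil_mem_of_kstar_eq hstar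
  have happ (u v) (hu : u ∈ R) (hv : v ∈ R) := Language.append_mem_of_kstar_eq hstar hu hv
  clear hstar
  obtain ⟨σ, _, D, rfl⟩ := hR
  have key := hW.transduction_of_length_le (E := fun s b t => {o | TableStep D s b t o}) 2
    (by rintro s b t o (_ | _ | _ | _ | _ | _) <;> simp) (0, D.start) (2, D.start)
  refine (congrArg _ (Set.Subset.antisymm ?_ ?_)).mp key
  · rintro y ⟨w, hw, ht⟩
    obtain ⟨x, z, rfl, he⟩ := sound w hw
    obtain ⟨u, v, rfl, hu, hv, e, he', y', rfl, ht'⟩ := (transduces_table_fst hnil).1 ht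
    obtain ⟨rfl, rfl⟩ := transduces_table_right.1 ht'
    refine ⟨u, hu, v, hv, z, he', ?_, by simp⟩
    rw [← he, ← map_mul]; rfl
  · rintro y ⟨u, hu, v, hv, z, hz, he, rfl⟩
    -- Closure under concatenation is what puts the pair `u ++ v`, `z` within reach of `complete`.
    refine ⟨_, complete (u ++ v) (happ u v hu hv) z hz ?_, ?_⟩
    · rw [← he, ← map_mul]; rfl
    · exact (transduces_table_fst hnil).2 ⟨u, v, rfl, hu, hv, _, hz, _, by simp,
        transduces_table_right.2 ⟨rfl, rfl⟩⟩

end MultiplicationTable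

/-! ### Insertions preserve equality of the two sides -/

section Soundness

variable {A M : Type*} [Monoid M]

/-- The words over `TwoSided A` that have the same value as a given symbol. -/
def symbolValueLanguage (π : FreeMonoid A →* M) : TwoSided A → Language (TwoSided A)
  | .left a => {y | ∃ x : List A, y = x.map .left ∧ π (.ofList x) = π (.of a)}
  | .mid => {y | ∃ x z : List A, y = x.map .left ++ .mid :: z.reverse.map .right ∧
      π (.ofList x) = π (.ofList z)}
  | .right a => {y | ∃ z : List A, y = z.reverse.map .right ∧ π (.ofList z) = π (.of a)}

theorem singleton_mem_symbolValueLanguage (π : FreeMonoid A →* M) (X : TwoSided A) :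
    [X] ∈ symbolValueLanguage π X := by
  cases X with
  | left a => exact ⟨[a], rfl, rfl⟩
  | mid => exact ⟨[], [], rfl, rfl⟩
  | right a => exact ⟨[a], rfl, rfl⟩

variable {π : FreeMonoid A →* M}

theorem exists_of_mem_prod_left {p : List A} {y : List (TwoSided A)}
    (h : y ∈ ((p.map .left).map (symbolValueLanguage π)).prod) :
    ∃ x : List A, y = x.map .left ∧ π (.ofList x) = π (.ofList p) := by
  induction p generalizing y with
  | nil => exact ⟨[], h, rfl⟩
  | cons a p ih =>
    obtain ⟨_, ⟨x₁, rfl, h₁⟩, y₂, hy₂, rfl⟩ := Language.mem_mul.1 h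
    obtain ⟨x₂, rfl, h₂⟩ := ih hy₂
    refine ⟨x₁ ++ x₂, List.map_append.symm, ?_⟩
    rw [FreeMonoid.ofList_append, FreeMonoid.ofList_cons, map_mul, map_mul, h₁, h₂]

theorem exists_of_mem_prod_right {q : List A} {y : List (TwoSided A)}
    (h : y ∈ ((q.reverse.map .right).map (symbolValueLanguage π)).prod) :
    ∃ z : List A, y = z.reverse.map .right ∧ π (.ofList z) = π (.ofList q) := by
  induction q generalizing y with
  | nil => exact ⟨[], h, rfl⟩
  | cons a q ih =>
    rw [List.reverse_cons, List.map_append, List.map_append, List.prod_append] at h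
    obtain ⟨y₂, hy₂, y₁, hy₁, rfl⟩ := Language.mem_mul.1 h
    rw [List.map_singleton, List.map_singleton, List.prod_singleton] at hy₁
    obtain ⟨x₁, rfl, h₁⟩ := hy₁
    obtain ⟨x₂, rfl, h₂⟩ := ih hy₂
    refine ⟨x₁ ++ x₂, by rw [List.reverse_append, List.map_append], ?_⟩
    rw [FreeMonoid.ofList_append, FreeMonoid.ofList_cons, map_mul, map_mul, h₁, h₂]

/-- At the central symbol both sides are multiplied on the left by the same value. At a letter one
of `p`, `q` is empty, so the other has value `1` and changes nothing. -/
theorem prod_symbolValueLanguage_le {p q : List A} (h : π (.ofList p) = π (.ofList q))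
    {X : TwoSided A} (hp : X.IsRight → p = []) (hq : X.IsLeft → q = []) :
    ((p.map TwoSided.left ++ X :: q.reverse.map TwoSided.right).map (symbolValueLanguage π)).prod ≤
      symbolValueLanguage π X := by
  intro y hy
  rw [List.map_append, List.prod_append, List.map_cons, List.prod_cons] at hy
  obtain ⟨y₁, hy₁, y', hy', rfl⟩ := Language.mem_mul.1 hy
  obtain ⟨y₂, hy₂, y₃, hy₃, rfl⟩ := Language.mem_mul.1 hy'
  obtain ⟨x, rfl, hx⟩ := exists_of_mem_prod_left hy₁
  obtain ⟨z, rfl, hz⟩ := exists_of_mem_prod_right hy₃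
  cases X with
  | left a =>
    obtain rfl := hq trivial
    have hz' : z.reverse.map .right = ([] : List (TwoSided A)) := hy₃
    obtain ⟨x₂, rfl, h₂⟩ := hy₂
    refine ⟨x ++ x₂, by rw [hz', List.append_nil, List.map_append], ?_⟩
    rw [FreeMonoid.ofList_append, map_mul, hx, h, h₂, FreeMonoid.ofList_nil, map_one, one_mul]
  | right a =>
    obtain rfl := hp trivial
    have hx' : x.map .left = ([] : List (TwoSided A)) := hy₁
    obtain ⟨z₂, rfl, h₂⟩ := hy₂
    refine ⟨z ++ z₂, by rw [hx', List.reverse_append, List.map_append]; rfl, ?_⟩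
    rw [FreeMonoid.ofList_append, map_mul, hz, ← h, h₂, FreeMonoid.ofList_nil, map_one, one_mul]
  | mid =>
    obtain ⟨x₂, z₂, rfl, h₂⟩ := hy₂
    refine ⟨x ++ x₂, z ++ z₂, by simp, ?_⟩
    rw [FreeMonoid.ofList_append, FreeMonoid.ofList_append, map_mul, map_mul, hx, hz, h, h₂]

end Soundness

/-! ### Block words and the free product -/

section FreeProduct

open Monoid

variable {ι : Type*} {A : ι → Type*} {M : ι → Type*} [∀ i, Monoid (M i)]

/-- The homomorphism from the free monoid over the disjoint union of the alphabets to the free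
product. -/
def coprodHom (π : ∀ i, FreeMonoid (A i) →* M i) : FreeMonoid (Σ i, A i) →* CoprodI M :=
  FreeMonoid.lift fun x => CoprodI.of (π x.1 (FreeMonoid.of x.2))

/-- The word over the disjoint union of the alphabets that is spelled by a list of blocks. -/
def blockWord (x : List (Σ i, List (A i))) : List (Σ i, A i) :=
  x.flatMap fun b => b.2.map (Sigma.mk b.1)

/-- The list of elements of the monoids that is represented by a list of blocks. -/
def blockValues (π : ∀ i, FreeMonoid (A i) →* M i) (x : List (Σ i, List (A i))) :
    List (Σ i, M i) :=
  x.map fun b => ⟨b.1, π b.1 (FreeMonoid.ofList b.2)⟩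

variable {π : ∀ i, FreeMonoid (A i) →* M i} {R : ∀ i, Language (A i)}

theorem coprodHom_map (i : ι) (u : List (A i)) :
    coprodHom π (FreeMonoid.ofList (u.map (Sigma.mk i))) =
      CoprodI.of (π i (FreeMonoid.ofList u)) := by
  induction u with
  | nil => simp
  | cons a u ih =>
    rw [List.map_cons, FreeMonoid.ofList_cons, FreeMonoid.ofList_cons, map_mul, map_mul, map_mul,
      ih]
    rfl

theorem coprodHom_blockWord (x : List (Σ i, List (A i))) :
    coprodHom π (FreeMonoid.ofList (blockWord x)) =
      ((blockValues π x).map fun l => CoprodI.of l.2).prod := by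
  induction x with
  | nil => simp [blockWord, blockValues]
  | cons b x ih =>
    rw [show blockWord (b :: x) = b.2.map (Sigma.mk b.1) ++ blockWord x from rfl,
      FreeMonoid.ofList_append, map_mul, ih, coprodHom_map]
    rfl

/-- The words by which the letter `x.2` may be replaced, using the monoid with index `x.1`. -/
abbrev insertionRules (π : ∀ i, FreeMonoid (A i) →* M i) (R : ∀ i, Language (A i))
    (x : ι × TwoSided (Σ i, A i)) : Language (TwoSided (Σ i, A i)) :=
  insertionLanguage (π x.1) (R x.1) (Sigma.mk x.1) x.2

/-- An equality in one factor persists in the free product, so each rule respects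
`symbolValueLanguage` of `coprodHom π`. -/
theorem exists_of_insertion_reaches {w : List (TwoSided (Σ i, A i))}
    (h : SubstReaches Prod.snd (insertionRules π R) [.mid] w) :
    ∃ x z, w = x.map .left ++ .mid :: z.reverse.map .right ∧
      coprodHom π (FreeMonoid.ofList x) = coprodHom π (FreeMonoid.ofList z) := by
  have key := h.mem_prod (singleton_mem_symbolValueLanguage (coprodHom π)) (by
    rintro ⟨i, X⟩ _ ⟨p, -, q, -, he, hp, hq, rfl⟩
    have := prod_symbolValueLanguage_le (π := coprodHom π) (p := p.map (Sigma.mk i))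
      (q := q.map (Sigma.mk i)) (X := X) (by rw [coprodHom_map, coprodHom_map, he])
      (fun h => by rw [hp h]; rfl) (fun h => by rw [hq h]; rfl)
    rwa [List.map_map, ← List.map_reverse, List.map_map] at this)
  rwa [List.map_singleton, List.prod_singleton] at key

theorem substStep_insertion {i : ι} {p q : List (A i)} (hp : p ∈ R i) (hq : q ∈ R i)
    (he : π i (FreeMonoid.ofList p) = π i (FreeMonoid.ofList q)) (X : TwoSided (Σ i, A i))
    (hp' : X.IsRight → p = []) (hq' : X.IsLeft → q = []) (u v : List (TwoSided (Σ i, A i))) :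
    SubstStep Prod.snd (insertionRules π R) (u ++ X :: v)
      (u ++ (p.map (.left ∘ Sigma.mk i) ++ X :: q.reverse.map (.right ∘ Sigma.mk i)) ++ v) :=
  SubstStep.mk (lhs := Prod.snd) (rhs := insertionRules π R) (i, X) u v
    ⟨p, hp, q, hq, he, hp', hq', rfl⟩

/-- An insertion needs a symbol to host it: the first letter of `v`, or the central symbol if `v` is
empty. -/
theorem substStep_insert_left {i : ι} {p : List (A i)} (hp : p ∈ R i) (hnil : [] ∈ R i)
    (he : π i (FreeMonoid.ofList p) = 1) (u v : List (Σ i, A i))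
    (r : List (TwoSided (Σ i, A i))) :
    SubstStep Prod.snd (insertionRules π R) ((u ++ v).map .left ++ .mid :: r)
      ((u ++ p.map (Sigma.mk i) ++ v).map .left ++ .mid :: r) := by
  have he : π i (FreeMonoid.ofList p) = π i (FreeMonoid.ofList []) := by simpa using he
  cases v with
  | nil =>
    simpa using substStep_insertion (π := π) hp hnil he .mid (fun h => h.elim) (fun _ => rfl)
      (u.map .left) r
  | cons a v =>
    simpa using substStep_insertion (π := π) hp hnil he (.left a) (fun h => h.elim) (fun _ => rfl)
      (u.map .left) (v.map .left ++ .mid :: r)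

theorem substStep_insert_right {i : ι} {q : List (A i)} (hq : q ∈ R i) (hnil : [] ∈ R i)
    (he : π i (FreeMonoid.ofList q) = 1) (u v : List (Σ i, A i))
    (l : List (TwoSided (Σ i, A i))) :
    SubstStep Prod.snd (insertionRules π R) (l ++ .mid :: (u ++ v).reverse.map .right)
      (l ++ .mid :: (u ++ q.map (Sigma.mk i) ++ v).reverse.map .right) := by
  have he : π i (FreeMonoid.ofList []) = π i (FreeMonoid.ofList q) := by simpa using he.symm
  cases v with
  | nil =>
    simpa using substStep_insertion (π := π) hnil hq he .mid (fun _ => rfl) (fun h => h.elim)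
      l (u.reverse.map .right)
  | cons a v =>
    convert substStep_insertion (π := π) hnil hq he (.right a) (fun _ => rfl) (fun h => h.elim)
      (l ++ .mid :: v.reverse.map .right) (u.reverse.map .right) using 1 <;> simp

/-- A list of blocks contains a block representing `1`, or two adjacent blocks over the same
alphabet, or it represents a reduced word of the free product. -/
theorem exists_block_or_reduced (π : ∀ i, FreeMonoid (A i) →* M i) (x : List (Σ i, List (A i))) :
    (∃ x₁ i p x₂, x = x₁ ++ ⟨i, p⟩ :: x₂ ∧ π i (FreeMonoid.ofList p) = 1) ∨
    (∃ x₁ i p q x₂, x = x₁ ++ ⟨i, p⟩ :: ⟨i, q⟩ :: x₂) ∨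
    ∃ w : CoprodI.Word M, w.toList = blockValues π x := by
  by_cases h₁ : ∀ l ∈ blockValues π x, l.2 ≠ 1
  · by_cases h₂ : (blockValues π x).IsChain fun l l' => l.1 ≠ l'.1
    · exact .inr (.inr ⟨⟨_, h₁, h₂⟩, rfl⟩)
    · refine .inr (.inl ?_)
      rw [blockValues, List.isChain_map, List.isChain_iff_forall_rel_of_append_cons_cons] at h₂
      push Not at h₂
      obtain ⟨⟨i, p⟩, ⟨j, q⟩, x₁, x₂, hx, h⟩ := h₂
      obtain rfl : i = j := h
      exact ⟨x₁, i, p, q, x₂, hx⟩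
  · refine .inl ?_
    push Not at h₁
    obtain ⟨l, hl, h⟩ := h₁
    obtain ⟨⟨i, p⟩, hp, rfl⟩ := List.mem_map.1 hl
    obtain ⟨x₁, x₂, rfl⟩ := List.append_of_mem hp
    exact ⟨x₁, i, p, x₂, rfl, h⟩

theorem blockWord_append (x y : List (Σ i, List (A i))) :
    blockWord (x ++ y) = blockWord x ++ blockWord y := List.flatMap_append

theorem blockWord_cons (b : Σ i, List (A i)) (x : List (Σ i, List (A i))) :
    blockWord (b :: x) = b.2.map (Sigma.mk b.1) ++ blockWord x := rfl

theorem blockWord_merge (x₁ x₂ : List (Σ i, List (A i))) (i : ι) (p q : List (A i)) :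
    blockWord (x₁ ++ ⟨i, p⟩ :: ⟨i, q⟩ :: x₂) = blockWord (x₁ ++ ⟨i, p ++ q⟩ :: x₂) := by
  simp [blockWord_append, blockWord_cons]

theorem coprodHom_blockWord_remove (x₁ x₂ : List (Σ i, List (A i))) {i : ι} {p : List (A i)}
    (h : π i (FreeMonoid.ofList p) = 1) :
    coprodHom π (FreeMonoid.ofList (blockWord (x₁ ++ ⟨i, p⟩ :: x₂))) =
      coprodHom π (FreeMonoid.ofList (blockWord (x₁ ++ x₂))) := by
  simp [blockWord_append, blockWord_cons, coprodHom_map, h]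

/-- Two lists of blocks with the same value can be built up simultaneously by insertions. -/
theorem insertion_reaches_of_blocks (hR : ∀ i, (R i)∗ = R i) (n : ℕ) :
    ∀ x z : List (Σ i, List (A i)), x.length + z.length ≤ n → (∀ b ∈ x, b.2 ∈ R b.1) →
      (∀ b ∈ z, b.2 ∈ R b.1) → coprodHom π (FreeMonoid.ofList (blockWord x)) =
        coprodHom π (FreeMonoid.ofList (blockWord z)) →
      SubstReaches Prod.snd (insertionRules π R) [.mid]
        ((blockWord x).map .left ++ .mid :: (blockWord z).reverse.map .right) := by
  induction n with
  | zero =>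
    intro x z hn _ _ _
    obtain rfl : x = [] := List.eq_nil_of_length_eq_zero (by omega)
    obtain rfl : z = [] := List.eq_nil_of_length_eq_zero (by omega)
    exact .refl
  | succ n ih =>
    intro x z hn hx hz he
    have hnil i := Language.nil_mem_of_kstar_eq (hR i)
    rcases exists_block_or_reduced π x with
      ⟨x₁, i, p, x₂, rfl, hp⟩ | ⟨x₁, i, p, q, x₂, rfl⟩ | ⟨wx, hwx⟩
    -- A block of value `1` is left out and inserted as the last step.
    · have h := ih (x₁ ++ x₂) z (by simp at hn ⊢; omega) (fun b hb => hx b (by simp at hb ⊢; tauto))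
        hz (by rw [← he, coprodHom_blockWord_remove _ _ hp])
      rw [blockWord_append] at h
      rw [blockWord_append, blockWord_cons, ← List.append_assoc]
      exact h.tail (substStep_insert_left (hx ⟨i, p⟩ (by simp)) (hnil i) hp _ _ _)
    -- Merging leaves the word unchanged but lowers the number of blocks; `R i` contains the merged
    -- block because it equals its own star.
    · rw [blockWord_merge] at he ⊢
      refine ih _ z (by simp at hn ⊢; omega) ?_ hz he
      have := Language.append_mem_of_kstar_eq (hR i) (hx ⟨i, p⟩ (by simp)) (hx ⟨i, q⟩ (by simp))
      intro b hb
      simp only [List.mem_append, List.mem_cons] at hb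
      rcases hb with hb | rfl | hb
      · exact hx b (by simp [hb])
      · exact this
      · exact hx b (by simp [hb])
    rcases exists_block_or_reduced π z with
      ⟨z₁, i, p, z₂, rfl, hp⟩ | ⟨z₁, i, p, q, z₂, rfl⟩ | ⟨wz, hwz⟩
    · have h := ih x (z₁ ++ z₂) (by simp at hn ⊢; omega) hx
        (fun b hb => hz b (by simp at hb ⊢; tauto)) (by rw [he, coprodHom_blockWord_remove _ _ hp])
      rw [blockWord_append z₁] at h
      rw [blockWord_append z₁, blockWord_cons, ← List.append_assoc]
      exact h.tail (substStep_insert_right (hz ⟨i, p⟩ (by simp)) (hnil i) hp _ _ _)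
    · rw [blockWord_merge z₁] at he ⊢
      refine ih x _ (by simp at hn ⊢; omega) hx ?_ he
      have := Language.append_mem_of_kstar_eq (hR i) (hz ⟨i, p⟩ (by simp)) (hz ⟨i, q⟩ (by simp))
      intro b hb
      simp only [List.mem_append, List.mem_cons] at hb
      rcases hb with hb | rfl | hb
      · exact hz b (by simp [hb])
      · exact this
      · exact hz b (by simp [hb])
    -- Both sides are now reduced, and a reduced word is determined by its product.
    have hv : blockValues π x = blockValues π z := by
      classical
      rw [coprodHom_blockWord, coprodHom_blockWord, ← hwx, ← hwz] at he
      have : wx = wz := CoprodI.Word.equiv.symm.injective he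
      rw [← hwx, ← hwz, this]
    rcases List.eq_nil_or_concat' x with rfl | ⟨x, ⟨i, p⟩, rfl⟩
    · obtain rfl : z = [] := List.map_eq_nil_iff.1 hv.symm
      exact .refl
    rcases List.eq_nil_or_concat' z with rfl | ⟨z, ⟨j, q⟩, rfl⟩
    · simp [blockValues] at hv
    rw [blockValues, blockValues, List.map_append, List.map_append] at hv
    obtain ⟨hv', hpq⟩ := List.append_inj' hv rfl
    obtain ⟨rfl, hpq⟩ : i = j ∧ π i (.ofList p) ≍ π j (.ofList q) := by simpa using hpq
    -- The last blocks are adjacent to the central symbol and have equal values, so a single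
    -- insertion there restores both.
    have h := ih x z (by simp at hn; omega) (fun b hb => hx b (by simp [hb]))
      (fun b hb => hz b (by simp [hb]))
      (by rw [coprodHom_blockWord, coprodHom_blockWord, blockValues, hv', blockValues])
    have hs := substStep_insertion (π := π) (hx ⟨i, p⟩ (by simp)) (hz ⟨i, q⟩ (by simp))
      (eq_of_heq hpq) .mid (fun h => h.elim) (fun h => h.elim) ((blockWord x).map .left)
      ((blockWord z).reverse.map .right)
    refine h.tail ?_
    simpa [blockWord_append, blockWord_cons, blockWord] using hs

/-- The regular combing of a free product. -/
def coprodCombing [Fintype ι] (R : ∀ i, Language (A i)) : Language (Σ i, A i) :=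
  (∑ i, Language.map (Sigma.mk i) (R i))∗

theorem mem_coprodCombing_iff [Fintype ι] {w : List (Σ i, A i)} :
    w ∈ coprodCombing R ↔ ∃ x : List (Σ i, List (A i)), (∀ b ∈ x, b.2 ∈ R b.1) ∧
      w = blockWord x := by
  rw [coprodCombing, Language.mem_kstar]
  constructor
  · rintro ⟨L, rfl, hL⟩
    induction L with
    | nil => exact ⟨[], by simp, rfl⟩
    | cons y L ih =>
      obtain ⟨x, hx, he⟩ := ih fun y hy => hL y (by simp [hy])
      obtain ⟨i, -, u, hu, rfl⟩ := Language.mem_sum.1 (hL y (by simp))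
      exact ⟨⟨i, u⟩ :: x, by simpa using ⟨hu, hx⟩, by rw [List.flatten_cons, he, blockWord_cons]⟩
  · rintro ⟨x, hx, rfl⟩
    refine ⟨x.map fun b => b.2.map (Sigma.mk b.1), rfl, ?_⟩
    intro y hy
    obtain ⟨b, hb, rfl⟩ := List.mem_map.1 hy
    exact Language.mem_sum.2 ⟨b.1, Finset.mem_univ _, b.2, hx b hb, rfl⟩

theorem exists_mem_coprodCombing [Fintype ι] (h : ∀ i, IsRegularCombing (π i) (R i))
    (m : CoprodI M) : ∃ u ∈ coprodCombing R, coprodHom π (FreeMonoid.ofList u) = m := by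
  induction m using CoprodI.induction_left with
  | one => exact ⟨[], Language.nil_mem_kstar _, map_one _⟩
  | @mul i m x ih =>
    obtain ⟨v, hv, rfl⟩ := ih
    obtain ⟨u, hu, rfl⟩ := (h i).2 m
    obtain ⟨b, hb, rfl⟩ := mem_coprodCombing_iff.1 hv
    exact ⟨blockWord (⟨i, u⟩ :: b), mem_coprodCombing_iff.2 ⟨_, by simpa using ⟨hu, hb⟩, rfl⟩,
      by rw [blockWord_cons, FreeMonoid.ofList_append, map_mul, coprodHom_map]⟩

end FreeProduct

/-! ### Finite families, isomorphic copies and the binary free product -/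

/-- The free product of a finite family of ⋆-word-hyperbolic monoids is ⋆-word-hyperbolic. -/
theorem IsStarWordHyperbolic.coprodI {ι : Type} [Finite ι] {M : ι → Type*} [∀ i, Monoid (M i)]
    (h : ∀ i, IsStarWordHyperbolic (M i)) : IsStarWordHyperbolic (Monoid.CoprodI M) := by
  have := Fintype.ofFinite ι
  choose A hA π R hR hstar using h
  have hstar' : (coprodCombing R)∗ = coprodCombing R := kstar_idem _
  have hreg : (coprodCombing R).IsRegular :=
    (Language.IsRegular.sum _ fun i => (hR i).1.1.map (Sigma.mk i)).kstar
  refine ⟨Σ i, A i, inferInstance, coprodHom π, coprodCombing R,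
    ⟨⟨hreg, exists_mem_coprodCombing fun i => (hR i).1⟩, ?_⟩, hstar'⟩
  refine isContextFree_multiplicationTable hreg hstar'
    (Language.IsContextFree.substReaches Prod.snd (rhs := insertionRules π R) ?_ .mid) ?_ ?_
  · exact fun x => (hR x.1).isContextFree_insertionLanguage
      (Language.nil_mem_of_kstar_eq (hstar x.1)) _ _
  · exact fun w hw => exists_of_insertion_reaches hw
  · intro x hx z hz he
    obtain ⟨x, hx', rfl⟩ := mem_coprodCombing_iff.1 hx
    obtain ⟨z, hz', rfl⟩ := mem_coprodCombing_iff.1 hz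
    exact insertion_reaches_of_blocks hstar _ x z le_rfl hx' hz' he

theorem IsStarWordHyperbolic.of_mulEquiv {M N : Type*} [Monoid M] [Monoid N] (e : M ≃* N)
    (h : IsStarWordHyperbolic M) : IsStarWordHyperbolic N := by
  obtain ⟨A, hA, π, R, ⟨⟨hreg, hsurj⟩, hcf⟩, hstar⟩ := h
  refine ⟨A, hA, e.toMonoidHom.comp π, R, ⟨⟨hreg, fun n => ?_⟩, ?_⟩, hstar⟩
  · obtain ⟨u, hu, h⟩ := hsurj (e.symm n)
    exact ⟨u, hu, by simp [h]⟩
  -- Since `e` is injective, the multiplication table is literally the same language.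
  · convert hcf using 1
    ext x
    simp only [multiplicationTable, MonoidHom.comp_apply, MulEquiv.toMonoidHom_eq_coe,
      MonoidHom.coe_coe, ← map_mul, e.injective.eq_iff]

section Binary

open Monoid

universe u v

/-- The family of two monoids, in a common universe. -/
def BoolFamily (M₁ : Type u) (M₂ : Type v) : Bool → Type (max u v)
  | true => ULift.{v} M₁
  | false => ULift.{u} M₂

instance BoolFamily.instMonoid (M₁ : Type u) (M₂ : Type v) [Monoid M₁] [Monoid M₂] :
    ∀ b, Monoid (BoolFamily M₁ M₂ b)
  | true => inferInstanceAs (Monoid (ULift M₁))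
  | false => inferInstanceAs (Monoid (ULift M₂))

/-- The free product of two monoids as the free product of a family. -/
def coprodIBoolFamilyEquiv (M₁ : Type u) (M₂ : Type v) [Monoid M₁] [Monoid M₂] :
    CoprodI (BoolFamily M₁ M₂) ≃* Coprod M₁ M₂ :=
  let f₁ : ULift.{v} M₁ →* Coprod M₁ M₂ := Coprod.inl.comp MulEquiv.ulift.toMonoidHom
  let f₂ : ULift.{u} M₂ →* Coprod M₁ M₂ := Coprod.inr.comp MulEquiv.ulift.toMonoidHom
  let g₁ : ULift.{v} M₁ →* CoprodI (BoolFamily M₁ M₂) :=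
    CoprodI.of (M := BoolFamily M₁ M₂) (i := true)
  let g₂ : ULift.{u} M₂ →* CoprodI (BoolFamily M₁ M₂) :=
    CoprodI.of (M := BoolFamily M₁ M₂) (i := false)
  MonoidHom.toMulEquiv
    (CoprodI.lift fun b => match b with
      | true => f₁
      | false => f₂)
    (Coprod.lift (g₁.comp MulEquiv.ulift.symm.toMonoidHom)
      (g₂.comp MulEquiv.ulift.symm.toMonoidHom))
    (by
      refine CoprodI.ext_hom _ _ ?_
      rintro (_ | _)
      · ext x
        simp only [MonoidHom.comp_apply, CoprodI.lift_of]
        rfl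
      · ext x
        simp only [MonoidHom.comp_apply, CoprodI.lift_of]
        rfl)
    (by
      refine Coprod.hom_ext ?_ ?_
      · ext x
        rfl
      · ext x
        rfl)

end Binary

theorem mainTheorem3 {M₁ M₂ : Type*} [Monoid M₁] [Monoid M₂]
    (h₁ : IsStarWordHyperbolic M₁) (h₂ : IsStarWordHyperbolic M₂) :
    IsStarWordHyperbolic (Monoid.Coprod M₁ M₂) := by
  refine (IsStarWordHyperbolic.coprodI (M := BoolFamily M₁ M₂) ?_).of_mulEquiv
    (coprodIBoolFamilyEquiv M₁ M₂)
  rintro (_ | _)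
  · exact h₂.of_mulEquiv MulEquiv.ulift.symm
  · exact h₁.of_mulEquiv MulEquiv.ulift.symm
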